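/- All graphs are finite and simple. For a graph $G=(V,E)$ the unit sphere $S(x)$ of a vertex $x$ is the subgraph induced on the neighbours of $x$. Contractible graphs are defined recursively: the one-point graph is contractible, and $G$ is contractible if it has a vertex $x$ such that both $S(x)$ and the graph $G-x$ are contractible. The $(-1)$-sphere is the empty graph; for $d\ge 0$, a $d$-sphere is a graph all of whose unit spheres are $(d-1)$-spheres and which has a vertex $x$ such that $G-x$ is contractible; there are no $d$-spheres with $d<-1$. A $d$-graph is a graph all of whose unit spheres are $(d-1)$-spheres (so the empty graph is a $d$-graph for every $d$, and the only one if $d<0$). The Barycentric refinement $G_1$ of $G$ has as vertices the nonempty complete subgraphs (simplices) of $G$, two different ones being adjacent if one is contained in the other; $G_2=(G_1)_1$. For $f:V\to\mathbb{R}$, the graph $\{f=0\}$ is the subgraph of $G_1$ induced on the simplices containing both a vertex with $f<0$ and a vertex with $f>0$. A function $f:V\to\mathbb R$ is strongly locally injective if, for each complete subgraph $x$ of $G$, the family of values $(f(v))_{v\in x}$ is linearly independent over $\mathbb{Q}$. **Corollary.** Let $d\ge 0$ and let $G=(V,E)$ be a $d$-graph. For $k=2,3$ let $f_k:V\to\mathbb{R}$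 be an eigenfunction of the graph Laplacian $L$ of $G$ belonging to its $k$-th smallest eigenvalue (eigenvalues being listed in increasing order, either with or without multiplicity). Assume that $f_2$ and $f_3$ are strongly locally injective and do not take the value $0$. Extend $f_3$ to the vertices of the graph $\{f_2=0\}$ by averaging, $\overline f_3(x)=\frac1{|x|}\sum_{v\in x}f_3(v)$, and let the double nodal surface be the graph $\{\overline f_3=0\}$ formed inside the graph $\{f_2=0\}$, whose vertices are the complete subgraphs of $\{f_2=0\}$ on which $\overline f_3$ changes sign. Then the double nodal surface is a (possibly empty) $(d-2)$-graph, and it is in a natural way an induced subgraph of $G_2$: sending each complete subgraph of $\{f_2=0\}$ to the same set of simplices, viewed as a complete subgraph of $G_1$, embeds it in $G_2$. -/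

import Mathlib

universe u

namespace KnillGraph

/-- The unit sphere `S(x)`: the subgraph induced on the neighbours of `x`. -/
def unitSphere {V : Type u} (G : SimpleGraph V) (x : V) : SimpleGraph (G.neighborSet x) :=
  G.induce (G.neighborSet x)

/-- The graph `G - x`, induced on all vertices different from `x`. -/
def removeVertex {V : Type u} (G : SimpleGraph V) (x : V) : SimpleGraph ({x}ᶜ : Set V) :=
  G.induce {x}ᶜ

/-- Contractible graphs: the one-point graph is contractible, and `G` is contractible if it has
a vertex `x` such that both `S(x)` and `G - x` are contractible. -/
inductive IsContractible : ∀ {V : Type u}, SimpleGraph V → Prop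
  | point {V : Type u} (G : SimpleGraph V) (hne : Nonempty V) (hsub : Subsingleton V) :
      IsContractible G
  | step {V : Type u} (G : SimpleGraph V) (x : V) (hS : IsContractible (unitSphere G x))
      (hR : IsContractible (removeVertex G x)) : IsContractible G

/-- `IsSphereSucc n G` says that `G` is an `(n - 1)`-sphere: the `(-1)`-sphere is the empty graph,
and a `d`-sphere, `d ≥ 0`, is a graph all of whose unit spheres are `(d - 1)`-spheres and which
becomes contractible on removing some single vertex. -/
def IsSphereSucc : ℕ → ∀ {V : Type u}, SimpleGraph V → Prop
  | 0, V, _ => IsEmpty V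
  | n + 1, V, G => (∀ x : V, IsSphereSucc n (unitSphere G x)) ∧
      ∃ x : V, IsContractible (removeVertex G x)

/-- `G` is a `d`-sphere. There are none with `d < -1`; the `(-1)`-sphere is the empty graph. -/
def IsSphere (d : ℤ) {V : Type u} (G : SimpleGraph V) : Prop :=
  ∃ n : ℕ, (n : ℤ) = d + 1 ∧ IsSphereSucc n G

/-- `G` is a `d`-graph: every unit sphere is a `(d - 1)`-sphere. In particular the empty graph is
a `d`-graph for each `d`, and for `d < 0` it is the only one. -/
def IsDGraph (d : ℤ) {V : Type u} (G : SimpleGraph V) : Prop :=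
  ∀ x : V, IsSphere (d - 1) (unitSphere G x)

/-- The simplices of `G`: nonempty complete subgraphs, given by their vertex sets. -/
def Simplex {V : Type u} (G : SimpleGraph V) : Type u :=
  {s : Finset V // s.Nonempty ∧ G.IsClique (s : Set V)}

/-- The Barycentric refinement `G₁`: its vertices are the simplices of `G`, and two different
simplices are adjacent if one is contained in the other. -/
def barycentric {V : Type u} (G : SimpleGraph V) : SimpleGraph (Simplex G) where
  Adj s t := s.1 ⊂ t.1 ∨ t.1 ⊂ s.1
  symm := ⟨fun _ _ h => h.symm⟩
  loopless := ⟨fun s h => h.elim (ssubset_irrefl s.1) (ssubset_irrefl s.1)⟩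

/-- The set of simplices on which `f - c` changes sign. -/
def levelSet {V : Type u} (G : SimpleGraph V) (f : V → ℝ) (c : ℝ) : Set (Simplex G) :=
  {s | (∃ v ∈ s.1, f v - c < 0) ∧ ∃ v ∈ s.1, 0 < f v - c}

/-- The level hypersurface `{f = c}`, an induced subgraph of the Barycentric refinement. -/
def levelSurface {V : Type u} (G : SimpleGraph V) (f : V → ℝ) (c : ℝ) :
    SimpleGraph (levelSet G f c) :=
  (barycentric G).induce (levelSet G f c)

/-- The extension of `g` from the vertices of `G` to the simplices of `G` by averaging. -/
noncomputable def simplexAverage {V : Type u} (G : SimpleGraph V) (g : V → ℝ) (s : Simplex G) : ℝ :=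
  (∑ v ∈ s.1, g v) / (s.1.card : ℝ)

/-- The surface `{g = 0}` inside the surface `{f = 0}`: first form the graph `{f = 0}`, whose
vertices are simplices of `G`, extend `g` to it by averaging, and take the zero locus there. -/
noncomputable def doubleNodalSurface {V : Type u} (G : SimpleGraph V) (f g : V → ℝ) :
    SimpleGraph (levelSet (levelSurface G f 0) (fun s => simplexAverage G g s.1) 0) :=
  levelSurface (levelSurface G f 0) (fun s => simplexAverage G g s.1) 0

/-- `f` is strongly locally injective: on each complete subgraph the (indexed) family of values
of `f` is linearly independent over `ℚ`. -/
def StronglyLocallyInjective {V : Type u} (G : SimpleGraph V) (f : V → ℝ) : Prop :=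
  ∀ s : Finset V, G.IsClique (s : Set V) → LinearIndependent ℚ (fun v : s => f v)

/-- `f` is an eigenfunction of the graph Laplacian belonging to the `k`-th smallest eigenvalue
(`k = 1, 2, …`), where the eigenvalues are listed increasingly either with multiplicity or without
(both conventions are admitted). -/
def IsKthEigenfunction {V : Type u} [Fintype V] [DecidableEq V] (G : SimpleGraph V)
    [DecidableRel G.Adj] (k : ℕ) (f : V → ℝ) : Prop :=
  ∃ ev : ℝ, Module.End.HasEigenvector (Matrix.toLin' (G.lapMatrix ℝ)) ev f ∧
    (((G.lapMatrix ℝ).charpoly.roots.sort (· ≤ ·))[k - 1]? = some ev ∨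
      ((G.lapMatrix ℝ).charpoly.roots.toFinset.sort (· ≤ ·))[k - 1]? = some ev)

end KnillGraph

/-!
If `G` is a `d`-graph and `f` avoids the value `c`, then `{f = c}` is a `(d - 1)`-graph
(`IsDGraph.levelSurface`). This is applied to `f₂` on `G` and then to the average of `f₃` on
`{f₂ = 0}`, which does not vanish because the values of `f₃` on a simplex are linearly independent
over `ℚ`.

The unit sphere in `{f = c}` of a simplex `s` on which `f - c` changes sign is a join of two parts.
The simplices strictly inside `s` on which the sign changes are determined by a nonempty set of
negative and a nonempty set of positive vertices, not both full; they form the refined boundary of a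
product of two simplices, a `(|s| - 3)`-sphere (`sphereOn_mixed`). The simplices strictly containing
`s` form the Barycentric refinement of the link of `s`, which is a `(d - |s|)`-sphere because links
of spheres are spheres (`SphereOn.link`) and refinements of spheres are spheres
(`SphereOn.cofaces`). The join of the two is a `(d - 2)`-sphere (`SphereOn.join`).

The contractibility statements all rest on `ContractibleOn.extend`: vertices may be attached one at
a time as long as each meets the previous ones in a contractible set, usually a cone. For posets
this shows that a closure operator with contractible image has contractible domain.

All graphs that occur are treated as sets of vertices of an ambient graph, which is `G` itself or the
comparability graph of inclusion on `Finset V`. The latter contains the refinement and the level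
surface, with the simplices over `s` realized as the supersets of `s`, so that no isomorphism
between different vertex types has to be transported.
-/

namespace KnillGraph

universe v

/-! ### Contractible sets and spheres inside an ambient graph -/

/-- The set `S` of vertices of `H` induces a contractible graph. Keeping the ambient graph fixed
replaces isomorphisms between iterated induced subgraphs by equalities of sets. -/
inductive ContractibleOn {W : Type v} (H : SimpleGraph W) : Set W → Prop
  | point (x : W) : ContractibleOn H {x}
  | step {S : Set W} (x : W) (hx : x ∈ S) (hN : ContractibleOn H (S ∩ H.neighborSet x))
      (hR : ContractibleOn H (S \ {x})) : ContractibleOn H S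

/-- The set `S` of vertices of `H` induces an `(n - 1)`-sphere; the index is shifted as in
`IsSphereSucc`, so that the index of a join is the sum of the indices. -/
def SphereOn {W : Type v} (H : SimpleGraph W) : ℕ → Set W → Prop
  | 0, S => S = ∅
  | n + 1, S => (∀ x ∈ S, SphereOn H n (S ∩ H.neighborSet x)) ∧
      ∃ x ∈ S, ContractibleOn H (S \ {x})

section Bridge

variable {V : Type u} {W : Type v} {K : SimpleGraph V} {H : SimpleGraph W}

/-- The restriction of an embedding of `K` to the unit sphere of a vertex. -/
def unitSphereEmbedding (e : K ↪g H) (x : V) : unitSphere K x ↪g H :=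
  e.comp (SimpleGraph.Embedding.induce (G := K) (K.neighborSet x))

/-- The restriction of an embedding of `K` to the complement of a vertex. -/
def removeVertexEmbedding (e : K ↪g H) (x : V) : removeVertex K x ↪g H :=
  e.comp (SimpleGraph.Embedding.induce (G := K) {x}ᶜ)

theorem range_unitSphereEmbedding (e : K ↪g H) (x : V) :
    Set.range (unitSphereEmbedding e x) = Set.range e ∩ H.neighborSet (e x) := by
  ext w
  constructor
  · rintro ⟨a, rfl⟩
    exact ⟨⟨a.1, rfl⟩, e.map_adj_iff.2 a.2⟩
  · rintro ⟨⟨a, rfl⟩, ha⟩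
    exact ⟨⟨a, e.map_adj_iff.1 ha⟩, rfl⟩

theorem range_removeVertexEmbedding (e : K ↪g H) (x : V) :
    Set.range (removeVertexEmbedding e x) = Set.range e \ {e x} := by
  ext w
  constructor
  · rintro ⟨a, rfl⟩
    exact ⟨⟨a.1, rfl⟩, fun h => a.2 (e.injective h)⟩
  · rintro ⟨⟨a, rfl⟩, ha⟩
    exact ⟨⟨a, fun h => ha (congrArg e h)⟩, rfl⟩

theorem IsContractible.contractibleOn_range (h : IsContractible K) :
    ∀ e : K ↪g H, ContractibleOn H (Set.range e) := by
  induction h with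
  | point G hne hsub =>
    intro e
    obtain ⟨x⟩ := hne
    have : Set.range e = {e x} := by
      ext w
      constructor
      · rintro ⟨a, rfl⟩
        exact congrArg e (Subsingleton.elim a x)
      · rintro rfl
        exact ⟨x, rfl⟩
    rw [this]
    exact .point _
  | step G x _ _ ihS ihR =>
    intro e
    exact .step (e x) ⟨x, rfl⟩ (range_unitSphereEmbedding e x ▸ ihS _)
      (range_removeVertexEmbedding e x ▸ ihR _)

theorem ContractibleOn.isContractible {S : Set W} (h : ContractibleOn H S) :
    ∀ {V : Type u} {K : SimpleGraph V} (e : K ↪g H), Set.range e = S → IsContractible K := by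
  induction h with
  | point x =>
    intro V K e he
    obtain ⟨a, -⟩ : x ∈ Set.range e := he ▸ rfl
    refine .point K ⟨a⟩ ⟨fun a b => e.injective ?_⟩
    have h1 : e a ∈ Set.range e := ⟨a, rfl⟩
    have h2 : e b ∈ Set.range e := ⟨b, rfl⟩
    rw [he] at h1 h2
    exact h1.trans h2.symm
  | step x hx _ _ ihN ihR =>
    intro V K e he
    subst he
    obtain ⟨a, rfl⟩ := hx
    exact .step K a (ihN _ (range_unitSphereEmbedding e a))
      (ihR _ (range_removeVertexEmbedding e a))

theorem isSphereSucc_iff_sphereOn_range (n : ℕ) :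
    ∀ {V : Type u} {K : SimpleGraph V} (e : K ↪g H),
      IsSphereSucc n K ↔ SphereOn H n (Set.range e) := by
  induction n with
  | zero =>
    intro V K e
    exact Set.range_eq_empty_iff.symm
  | succ n ih =>
    intro V K e
    have hN (x : V) : IsSphereSucc n (unitSphere K x) ↔
        SphereOn H n (Set.range e ∩ H.neighborSet (e x)) := by
      rw [ih (unitSphereEmbedding e x), range_unitSphereEmbedding]
    have hR (x : V) : IsContractible (removeVertex K x) ↔
        ContractibleOn H (Set.range e \ {e x}) := by
      rw [← range_removeVertexEmbedding]
      exact ⟨fun h => h.contractibleOn_range _, fun h => h.isContractible _ rfl⟩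
    simp only [IsSphereSucc, SphereOn, Set.forall_mem_range, Set.exists_range_iff, hN, hR]

end Bridge

/-! ### Cones, joins and successive extensions -/

section Ambient

variable {W : Type v} {H : SimpleGraph W}

theorem ContractibleOn.finite {S : Set W} (h : ContractibleOn H S) : S.Finite := by
  induction h with
  | point x => exact Set.finite_singleton x
  | step x _ _ _ _ ihR => exact ihR.of_sdiff (Set.finite_singleton x)

theorem SphereOn.finite {n : ℕ} {S : Set W} (h : SphereOn H n S) : S.Finite := by
  cases n with
  | zero => rw [show S = ∅ from h]; exact Set.finite_empty
  | succ n =>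
    obtain ⟨-, x, -, hx⟩ := h
    exact hx.finite.of_sdiff (Set.finite_singleton x)

/-- A contractible set may be joined with any finite set. For a point this is a cone, dismantled
from its base. -/
theorem ContractibleOn.join {A B : Set W} (hA : ContractibleOn H A) (hB : B.Finite)
    (hAB : ∀ a ∈ A, ∀ b ∈ B, H.Adj a b) : ContractibleOn H (A ∪ B) := by
  induction hA generalizing B with
  | point c =>
    induction hn : B.ncard using Nat.strong_induction_on generalizing B with
    | _ n ih =>
      rcases B.eq_empty_or_nonempty with rfl | ⟨b, hb⟩
      · rw [Set.union_empty]; exact .point c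
      · have hcb : H.Adj c b := hAB c rfl b hb
        have key : ∀ B' ⊆ B, b ∉ B' → ContractibleOn H ({c} ∪ B') := fun B' hB' hb' =>
          ih _ (hn ▸ Set.ncard_lt_ncard ⟨hB', fun h => hb' (h hb)⟩ hB) (hB.subset hB')
            (fun a ha x hx => hAB a ha x (hB' hx)) rfl
        refine .step b (Or.inr hb) ?_ ?_
        · have h := key (B ∩ H.neighborSet b) Set.inter_subset_left (fun h => H.irrefl h.2)
          convert h using 1
          rw [Set.union_inter_distrib_right]
          congr 1
          exact Set.inter_eq_left.2 (by rintro _ rfl; exact hcb.symm)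
        · have h := key (B \ {b}) Set.sdiff_subset (fun h => h.2 rfl)
          convert h using 1
          rw [Set.union_sdiff_distrib]
          congr 1
          exact sdiff_eq_left.2 (Set.disjoint_singleton.2 hcb.ne)
  | @step S x hx _ _ ihN ihR =>
    refine .step x (Or.inl hx) ?_ ?_
    · have h := ihN hB (fun a ha b hb => hAB a ha.1 b hb)
      convert h using 1
      rw [Set.union_inter_distrib_right]
      congr 1
      exact Set.inter_eq_left.2 fun b hb => hAB x hx b hb
    · have h := ihR hB (fun a ha b hb => hAB a ha.1 b hb)
      convert h using 1
      rw [Set.union_sdiff_distrib]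
      congr 1
      exact sdiff_eq_left.2
        (Set.disjoint_singleton_right.2 fun h => (hAB x hx x h).ne rfl)

theorem ContractibleOn.of_apex {S : Set W} (hS : S.Finite) (c : W) (hc : c ∈ S)
    (h : ∀ x ∈ S, x ≠ c → H.Adj c x) : ContractibleOn H S := by
  have := (ContractibleOn.point (H := H) c).join (hS.subset (Set.sdiff_subset (t := {c})))
    (by rintro _ rfl x hx; exact h x hx.1 hx.2)
  rwa [Set.union_sdiff_cancel (Set.singleton_subset_iff.2 hc)] at this

/-- The elements of `S` outside `T` may be attached in the order of increasing `r`, if each of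
them meets what is present at that moment in a contractible set. Adjacent elements are required
to have different rank, so that the order among elements of the same rank does not matter. -/
theorem ContractibleOn.extend {S T : Set W} (r : W → ℤ) (hT : ContractibleOn H T) (hTS : T ⊆ S)
    (hS : S.Finite) (hr : ∀ x ∈ S, ∀ y ∈ S, H.Adj x y → r x ≠ r y)
    (hx : ∀ x ∈ S, x ∉ T →
      ContractibleOn H ({y ∈ S | y ∈ T ∨ r y < r x} ∩ H.neighborSet x)) :
    ContractibleOn H S := by
  induction hn : S.ncard using Nat.strong_induction_on generalizing S with
  | _ n ih =>
    by_cases hST : S ⊆ T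
    · rwa [hST.antisymm hTS]
    · obtain ⟨z, hzS, hzT⟩ := Set.not_subset.1 hST
      obtain ⟨x, ⟨hxS, hxT⟩, hmax⟩ := (hS.subset (Set.sdiff_subset (t := T))).exists_maximalFor r
        (S \ T) ⟨z, hzS, hzT⟩
      refine .step x hxS ?_ (ih _ (hn ▸ Set.ncard_sdiff_singleton_lt_of_mem hxS hS)
        (fun t ht => ⟨hTS ht, fun h => hxT (h ▸ ht)⟩) (hS.subset Set.sdiff_subset)
        (fun a ha b hb => hr a ha.1 b hb.1) (fun y hy hyT => ?_) rfl)
      · convert hx x hxS hxT using 1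
        ext y
        constructor
        · rintro ⟨hy, hxy⟩
          refine ⟨⟨hy, ?_⟩, hxy⟩
          by_cases hyT : y ∈ T
          · exact Or.inl hyT
          · right
            rcases le_total (r x) (r y) with h | h
            · exact absurd (h.antisymm (hmax ⟨hy, hyT⟩ h)) (hr x hxS y hy hxy)
            · exact lt_of_le_of_ne h (hr x hxS y hy hxy).symm
        · rintro ⟨⟨hy, -⟩, hxy⟩
          exact ⟨hy, hxy⟩
      · convert hx y hy.1 hyT using 1
        ext w
        constructor
        · rintro ⟨⟨hw, hwT⟩, hyw⟩
          exact ⟨⟨hw.1, hwT⟩, hyw⟩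
        · rintro ⟨⟨hw, hwT⟩, hyw⟩
          refine ⟨⟨⟨hw, ?_⟩, hwT⟩, hyw⟩
          rintro rfl
          rcases hwT with h | h
          · exact hxT h
          · exact absurd (hmax ⟨hy.1, hyT⟩ h.le) (not_le.2 h)

theorem SphereOn.join {m n : ℕ} {A B : Set W} (hA : SphereOn H m A) (hB : SphereOn H n B)
    (hAB : ∀ a ∈ A, ∀ b ∈ B, H.Adj a b) : SphereOn H (m + n) (A ∪ B) := by
  induction hk : m + n generalizing m n A B with
  | zero =>
    obtain ⟨rfl, rfl⟩ : m = 0 ∧ n = 0 := by omega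
    rw [show A = ∅ from hA, show B = ∅ from hB]
    exact Set.union_empty _
  | succ k ih =>
    have hAN : ∀ x ∈ A, (A ∪ B) ∩ H.neighborSet x = (A ∩ H.neighborSet x) ∪ B := by
      intro x hx
      rw [Set.union_inter_distrib_right]
      congr 1
      exact Set.inter_eq_left.2 fun b hb => hAB x hx b hb
    have hBN : ∀ x ∈ B, (A ∪ B) ∩ H.neighborSet x = A ∪ (B ∩ H.neighborSet x) := by
      intro x hx
      rw [Set.union_inter_distrib_right]
      congr 1
      exact Set.inter_eq_left.2 fun a ha => (hAB a ha x hx).symm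
    refine ⟨?_, ?_⟩
    · rintro x (hx | hx)
      · rw [hAN x hx]
        cases m with
        | zero => rw [show A = ∅ from hA] at hx; exact hx.elim
        | succ m => exact ih (hA.1 x hx) hB (fun a ha b hb => hAB a ha.1 b hb) (by omega)
      · rw [hBN x hx]
        cases n with
        | zero => rw [show B = ∅ from hB] at hx; exact hx.elim
        | succ n => exact ih hA (hB.1 x hx) (fun a ha b hb => hAB a ha b hb.1) (by omega)
    · cases m with
      | succ m =>
        obtain ⟨-, x, hx, hc⟩ := hA
        refine ⟨x, Or.inl hx, ?_⟩
        have h := hc.join hB.finite (fun a ha b hb => hAB a ha.1 b hb)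
        convert h using 1
        rw [Set.union_sdiff_distrib]
        congr 1
        exact sdiff_eq_left.2
          (Set.disjoint_singleton_right.2 fun h => (hAB x hx x h).ne rfl)
      | zero =>
        obtain rfl : n = k + 1 := by omega
        obtain ⟨-, x, hx, hc⟩ := hB
        rw [show A = ∅ from hA, Set.empty_union]
        exact ⟨x, hx, hc⟩

/-- The link of a clique `t` in a sphere is a sphere whose dimension is smaller by `|t|`. -/
theorem SphereOn.link [DecidableEq W] (t : Finset W) {n : ℕ} {S : Set W} (hS : SphereOn H n S)
    (htS : ∀ v ∈ t, v ∈ S) (ht : H.IsClique (t : Set W)) :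
    ∃ m, m + t.card = n ∧ SphereOn H m {w ∈ S | ∀ v ∈ t, H.Adj v w} := by
  induction t using Finset.induction_on generalizing n S with
  | empty => exact ⟨n, rfl, by simpa using hS⟩
  | insert a t ha ih =>
    rw [Finset.coe_insert, SimpleGraph.isClique_insert_of_notMem (by simpa using ha)] at ht
    have haS := htS a (Finset.mem_insert_self a t)
    cases n with
    | zero => rw [show S = ∅ from hS] at haS; exact haS.elim
    | succ n =>
      obtain ⟨m, hm, h⟩ := ih (hS.1 a haS)
        (fun v hv => ⟨htS v (Finset.mem_insert_of_mem hv), ht.2 v hv⟩) ht.1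
      refine ⟨m, by rw [Finset.card_insert_of_notMem ha]; omega, ?_⟩
      convert h using 1
      ext w
      simp [and_assoc]

end Ambient

/-! ### Posets of finite sets -/

/-- The comparability graph of inclusion on all finite sets of vertices; the Barycentric
refinement of a graph and its level surfaces are induced subgraphs of it. -/
def comparability (V : Type u) : SimpleGraph (Finset V) where
  Adj s t := s ⊂ t ∨ t ⊂ s
  symm := ⟨fun _ _ h => h.symm⟩
  loopless := ⟨fun s h => h.elim (ssubset_irrefl s) (ssubset_irrefl s)⟩

section Posets

variable {V : Type u}

theorem comparability_card_ne {s t : Finset V} (h : (comparability V).Adj s t) :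
    s.card ≠ t.card := by
  rcases h with h | h
  · exact (Finset.card_lt_card h).ne
  · exact (Finset.card_lt_card h).ne'

theorem comparability_adj_of_subset {s t : Finset V} (h : s ⊆ t ∨ t ⊆ s) (hne : s ≠ t) :
    (comparability V).Adj s t := by
  rcases h with h | h
  · exact Or.inl (h.ssubset_of_ne hne)
  · exact Or.inr (h.ssubset_of_ne hne.symm)

/-- A finite poset is contractible if the image of a closure operator on it is. -/
theorem ContractibleOn.of_closure {S : Set (Finset V)} (hS : S.Finite) (f : Finset V → Finset V)
    (hfS : ∀ s ∈ S, f s ∈ S) (hle : ∀ s ∈ S, s ⊆ f s) (hmono : ∀ s ∈ S, ∀ t ∈ S, s ⊆ t → f s ⊆ f t)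
    (hidem : ∀ s ∈ S, f (f s) = f s)
    (h : ContractibleOn (comparability V) {s ∈ S | f s = s}) :
    ContractibleOn (comparability V) S := by
  refine h.extend (fun s => (s.card : ℤ)) (fun s hs => hs.1) hS
    (fun s _ t _ hst => by exact_mod_cast comparability_card_ne hst) (fun s hs hsT => ?_)
  have hne : s ≠ f s := fun h => hsT ⟨hs, h.symm⟩
  refine .of_apex (hS.subset fun t ht => ht.1.1) (f s)
    ⟨⟨hfS s hs, Or.inl ⟨hfS s hs, hidem s hs⟩⟩, comparability_adj_of_subset (Or.inl (hle s hs)) hne⟩ ?_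
  rintro t ⟨⟨ht, htT⟩, hst⟩ htf
  refine comparability_adj_of_subset ?_ htf.symm
  rcases hst with hst | hst
  · left
    rcases htT with htT | htT
    · exact htT.2 ▸ hmono s hs t ht hst.subset
    · have := Finset.card_lt_card hst
      omega
  · exact Or.inr (hst.subset.trans (hle s hs))

/-- A finite poset is contractible if the image of a coclosure operator on it is. -/
theorem ContractibleOn.of_coclosure {S : Set (Finset V)} (hS : S.Finite)
    (f : Finset V → Finset V) (hfS : ∀ s ∈ S, f s ∈ S) (hle : ∀ s ∈ S, f s ⊆ s)
    (hmono : ∀ s ∈ S, ∀ t ∈ S, s ⊆ t → f s ⊆ f t) (hidem : ∀ s ∈ S, f (f s) = f s)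
    (h : ContractibleOn (comparability V) {s ∈ S | f s = s}) :
    ContractibleOn (comparability V) S := by
  refine h.extend (fun s => -(s.card : ℤ)) (fun s hs => hs.1) hS
    (fun s _ t _ hst => by have := comparability_card_ne hst; omega) (fun s hs hsT => ?_)
  have hne : s ≠ f s := fun h => hsT ⟨hs, h.symm⟩
  refine .of_apex (hS.subset fun t ht => ht.1.1) (f s)
    ⟨⟨hfS s hs, Or.inl ⟨hfS s hs, hidem s hs⟩⟩, comparability_adj_of_subset (Or.inr (hle s hs)) hne⟩ ?_
  rintro t ⟨⟨ht, htT⟩, hst⟩ htf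
  refine comparability_adj_of_subset ?_ htf.symm
  rcases hst with hst | hst
  · exact Or.inl ((hle s hs).trans hst.subset)
  · right
    rcases htT with htT | htT
    · exact htT.2 ▸ hmono t ht s hs hst.subset
    · have := Finset.card_lt_card hst
      omega

/-- An open interval in the lattice of finite sets is the refined boundary of a simplex. -/
theorem sphereOn_Ioo [DecidableEq V] (n : ℕ) (x y : Finset V) (hxy : x ⊆ y)
    (hn : y.card = x.card + n + 1) : SphereOn (comparability V) n (Set.Ioo x y) := by
  induction n using Nat.strong_induction_on generalizing x y with
  | _ n ih =>
    cases n with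
    | zero =>
      refine Set.eq_empty_of_forall_notMem fun s hs => ?_
      have h1 := Finset.card_lt_card hs.1
      have h2 := Finset.card_lt_card hs.2
      omega
    | succ n =>
      refine ⟨fun s hs => ?_, ?_⟩
      · have h1 := Finset.card_lt_card hs.1
        have h2 := Finset.card_lt_card hs.2
        have hlow := ih (s.card - x.card - 1) (by omega) x s hs.1.le (by omega)
        have hup := ih (y.card - s.card - 1) (by omega) s y hs.2.le (by omega)
        have h := hlow.join hup (fun a ha b hb => Or.inl (ha.2.trans hb.1))
        rw [show s.card - x.card - 1 + (y.card - s.card - 1) = n by omega] at h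
        convert h using 1
        ext t
        constructor
        · rintro ⟨ht, hst | hst⟩
          · exact Or.inr ⟨hst, ht.2⟩
          · exact Or.inl ⟨ht.1, hst⟩
        · rintro (ht | ht)
          · exact ⟨⟨ht.1, ht.2.trans hs.2⟩, Or.inr ht.2⟩
          · exact ⟨⟨hs.1.trans ht.1, ht.2⟩, Or.inl ht.1⟩
      · obtain ⟨a, hay, hax⟩ := Finset.exists_of_ssubset
          (hxy.ssubset_of_ne (by rintro rfl; omega))
        have hfin : (Set.Ioo x y).Finite := Set.finite_Ioo x y
        have hya : (y.erase a).card + 1 = y.card := Finset.card_erase_add_one hay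
        have hmem : y.erase a ∈ Set.Ioo x y := by
          refine ⟨Finset.ssubset_iff_subset_ne.2 ⟨fun v hv => Finset.mem_erase.2
            ⟨fun h => hax (h ▸ hv), hxy hv⟩, ?_⟩, Finset.erase_ssubset hay⟩
          intro h
          rw [← h] at hya
          omega
        refine ⟨y.erase a, hmem, ?_⟩
        -- Off the facet opposite to `a`, adding `a` is a closure operator; its image is the star
        -- of `a`, a cone with apex `insert a x`.
        refine .of_closure (hfin.subset Set.sdiff_subset) (insert a) ?_ ?_ ?_ ?_ ?_
        · rintro s ⟨⟨h1, h2⟩, h3⟩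
          refine ⟨⟨h1.trans_le (Finset.subset_insert a s),
            (Finset.insert_subset hay h2.le).lt_of_ne ?_⟩, ?_⟩
          · intro h
            by_cases has : a ∈ s
            · rw [Finset.insert_eq_of_mem has] at h
              exact h2.ne h
            · exact h3 (by rw [Set.mem_singleton_iff, ← h, Finset.erase_insert has])
          · intro h
            have : a ∈ y.erase a := h ▸ Finset.mem_insert_self a s
            simp at this
        · exact fun s _ => Finset.subset_insert a s
        · exact fun s _ t _ h => Finset.insert_subset_insert a h
        · exact fun s _ => Finset.insert_idem a s
        · have hax' : (insert a x).card = x.card + 1 := Finset.card_insert_of_notMem hax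
          refine .of_apex (hfin.subset fun s hs => hs.1.1) (insert a x)
            ⟨⟨⟨Finset.ssubset_insert hax, (Finset.insert_subset hay hxy).lt_of_ne ?_⟩, ?_⟩,
              Finset.insert_idem a x⟩ ?_
          · intro h
            rw [h] at hax'
            omega
          · intro h
            have : a ∈ y.erase a := h ▸ Finset.mem_insert_self a x
            simp at this
          · rintro s ⟨⟨hs, -⟩, has⟩ hne
            refine comparability_adj_of_subset (Or.inl ?_) hne.symm
            rw [← has]
            exact Finset.insert_subset_insert a hs.1.le

/-- A finite set is mixed for the predicate `p` if it has members with and without `p`. -/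
def Mixed (p : V → Prop) (s : Finset V) : Prop :=
  (∃ v ∈ s, p v) ∧ ∃ v ∈ s, ¬ p v

theorem Mixed.mono {p : V → Prop} {s t : Finset V} (h : Mixed p s) (hst : s ⊆ t) : Mixed p t :=
  let ⟨⟨v, hv, hp⟩, w, hw, hq⟩ := h
  ⟨⟨v, hst hv, hp⟩, w, hst hw, hq⟩

theorem mixed_not_iff {p : V → Prop} {s : Finset V} : Mixed (fun v => ¬ p v) s ↔ Mixed p s := by
  simp only [Mixed, not_not]
  exact and_comm

/-- If `p` holds at a second element of `y` besides `a`, then the poset of mixed proper subsets of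
`y`, with the facet opposite to `a` removed, is contractible: adding `a` is a closure operator,
then discarding the other elements with `p` is a coclosure operator, and the resulting sets lie
below `a` together with all elements without `p`. -/
theorem contractibleOn_mixed_diff_erase [DecidableEq V] {p : V → Prop} {y : Finset V} {a b : V}
    (ha : a ∈ y) (hpa : p a) (hb : b ∈ y) (hpb : p b) (hab : b ≠ a) (hy : ∃ v ∈ y, ¬ p v) :
    ContractibleOn (comparability V) ({s | s ⊂ y ∧ Mixed p s} \ {y.erase a}) := by
  classical
  have hfin : {s | s ⊂ y ∧ Mixed p s}.Finite :=
    (Set.finite_Iio y).subset fun s hs => hs.1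
  have hnot : ∀ s : Finset V, a ∈ s → s ∉ ({y.erase a} : Set (Finset V)) := by
    intro s has h
    rw [Set.mem_singleton_iff] at h
    simp [h] at has
  refine .of_closure (hfin.subset Set.sdiff_subset) (insert a) ?_ ?_ ?_ ?_ ?_
  · rintro s ⟨⟨h1, h2⟩, h3⟩
    refine ⟨⟨(Finset.insert_subset ha h1.subset).ssubset_of_ne ?_,
      h2.mono (Finset.subset_insert a s)⟩, hnot _ (Finset.mem_insert_self a s)⟩
    intro h
    by_cases has : a ∈ s
    · rw [Finset.insert_eq_of_mem has] at h
      exact h1.ne h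
    · exact h3 (by rw [Set.mem_singleton_iff, ← h, Finset.erase_insert has])
  · exact fun s _ => Finset.subset_insert a s
  · exact fun s _ t _ h => Finset.insert_subset_insert a h
  · exact fun s _ => Finset.insert_idem a s
  refine .of_coclosure (hfin.subset fun s hs => hs.1.1) (fun s => s.filter fun v => ¬ p v ∨ v = a)
    ?_ ?_ ?_ ?_ ?_
  · rintro s ⟨⟨⟨h1, h2⟩, -⟩, h4⟩
    have has : a ∈ s := Finset.insert_eq_self.1 h4
    have has' : a ∈ s.filter fun v => ¬ p v ∨ v = a := by simp [has]
    obtain ⟨v, hv, hpv⟩ := h2.2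
    exact ⟨⟨⟨(Finset.filter_subset _ s).trans_ssubset h1, ⟨a, has', hpa⟩, v, by simp [hv, hpv], hpv⟩,
      hnot _ has'⟩, Finset.insert_eq_of_mem has'⟩
  · exact fun s _ => Finset.filter_subset _ s
  · exact fun s _ t _ h => Finset.filter_subset_filter _ h
  · intro s _
    simp [Finset.filter_filter]
  have hay : a ∈ y.filter fun v => ¬ p v ∨ v = a := by simp [ha]
  obtain ⟨w, hw, hpw⟩ := hy
  refine .of_apex (hfin.subset fun s hs => hs.1.1.1) (y.filter fun v => ¬ p v ∨ v = a)
    ⟨⟨⟨⟨(Finset.filter_subset _ y).ssubset_of_ne ?_, ⟨a, hay, hpa⟩, w, by simp [hw, hpw], hpw⟩,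
      hnot _ hay⟩, Finset.insert_eq_of_mem hay⟩, by simp [Finset.filter_filter]⟩ ?_
  · intro h
    rw [← h] at hb
    simp [hpb, hab] at hb
  · rintro s ⟨⟨⟨⟨h1, -⟩, -⟩, -⟩, h4⟩ hne
    refine comparability_adj_of_subset (Or.inr ?_) hne.symm
    rw [← h4]
    exact Finset.filter_subset_filter _ h1.subset

/-- The mixed proper subsets of a mixed set `y` form the refined boundary of the product of the
simplex on the elements with `p` and the simplex on the elements without `p`. -/
theorem sphereOn_mixed [DecidableEq V] (p : V → Prop) (n : ℕ) (y : Finset V) (hy : Mixed p y)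
    (hn : y.card = n + 2) : SphereOn (comparability V) n {s | s ⊂ y ∧ Mixed p s} := by
  induction n using Nat.strong_induction_on generalizing y with
  | _ n ih =>
    have two_le : ∀ s : Finset V, Mixed p s → 2 ≤ s.card := by
      rintro s ⟨⟨v, hv, hpv⟩, w, hw, hpw⟩
      exact Finset.one_lt_card.2 ⟨v, hv, w, hw, by rintro rfl; exact hpw hpv⟩
    cases n with
    | zero =>
      refine Set.eq_empty_of_forall_notMem fun s hs => ?_
      have h1 := Finset.card_lt_card hs.1
      have h2 := two_le s hs.2
      omega
    | succ n =>
      refine ⟨fun s hs => ?_, ?_⟩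
      · have h1 := Finset.card_lt_card hs.1
        have h2 := two_le s hs.2
        have hlow := ih (s.card - 2) (by omega) s hs.2 (by omega)
        have hup := sphereOn_Ioo (y.card - s.card - 1) s y hs.1.subset (by omega)
        have h := hlow.join hup (fun a ha b hb => Or.inl (ha.1.trans hb.1))
        rw [show s.card - 2 + (y.card - s.card - 1) = n by omega] at h
        convert h using 1
        ext t
        constructor
        · rintro ⟨ht, hst | hst⟩
          · exact Or.inr ⟨hst, ht.1⟩
          · exact Or.inl ⟨hst, ht.2⟩
        · rintro (ht | ht)
          · exact ⟨⟨ht.1.trans hs.1, ht.2⟩, Or.inr ht.1⟩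
          · exact ⟨⟨ht.2, hs.2.mono ht.1.le⟩, Or.inl ht.1⟩
      · obtain ⟨⟨v, hv, hpv⟩, w, hw, hpw⟩ := hy
        have hvw : v ≠ w := by rintro rfl; exact hpw hpv
        -- As `y` has a third element, one of the two classes has at least two elements.
        obtain ⟨b, hb, hbv, hbw⟩ : ∃ b ∈ y, b ≠ v ∧ b ≠ w := by
          by_contra! hcon
          have : y ⊆ {v, w} := fun b hb => by
            by_cases hbv : b = v
            · simp [hbv]
            · simp [hcon b hb hbv]
          have := (Finset.card_le_card this).trans Finset.card_le_two
          omega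
        by_cases hpb : p b
        · exact ⟨y.erase v, ⟨Finset.erase_ssubset hv, ⟨b, Finset.mem_erase.2 ⟨hbv, hb⟩, hpb⟩,
            w, Finset.mem_erase.2 ⟨hvw.symm, hw⟩, hpw⟩,
            contractibleOn_mixed_diff_erase hv hpv hb hpb hbv ⟨w, hw, hpw⟩⟩
        · refine ⟨y.erase w, ⟨Finset.erase_ssubset hw, ⟨v, Finset.mem_erase.2 ⟨hvw, hv⟩, hpv⟩,
            b, Finset.mem_erase.2 ⟨hbw, hb⟩, hpb⟩, ?_⟩
          have h := contractibleOn_mixed_diff_erase (p := fun v => ¬ p v) hw hpw hb hpb hbw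
            ⟨v, hv, not_not.2 hpv⟩
          simpa only [mixed_not_iff] using h

end Posets

/-! ### Barycentric refinement -/

section Refinement

variable {V : Type u} {G : SimpleGraph V}

/-- The sets `b ∪ t` with `t` a nonempty clique inside `S`. For `b` disjoint from `S` this is a copy
of the Barycentric refinement of the graph induced on `S`, placed among the supersets of `b`. -/
def cofaces (G : SimpleGraph V) (b : Finset V) (S : Set V) : Set (Finset V) :=
  {s | b ⊂ s ∧ (∀ v ∈ s, v ∉ b → v ∈ S) ∧
    ∀ v ∈ s, v ∉ b → ∀ w ∈ s, w ∉ b → v ≠ w → G.Adj v w}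

theorem cofaces_finite [DecidableEq V] {b : Finset V} {S : Set V} (hS : S.Finite) :
    (cofaces G b S).Finite := by
  refine (Set.finite_Iic (b ∪ hS.toFinset)).subset fun s hs v hv => ?_
  by_cases hvb : v ∈ b
  · exact Finset.mem_union_left _ hvb
  · exact Finset.mem_union_right _ (hS.mem_toFinset.2 (hs.2.1 v hv hvb))

theorem ssubset_insert_of_mem_cofaces [DecidableEq V] {b s : Finset V} {S : Set V} {x : V}
    (hs : s ∈ cofaces G b S) (hxs : x ∈ s) (hne : s ≠ insert x b) : insert x b ⊂ s :=
  (Finset.insert_subset hxs hs.1.subset).ssubset_of_ne hne.symm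

/-- Passing from `S \ {x}` to `S` attaches to the refinement the simplices containing `x`, the
largest first: each of them, except the vertex `x` itself, meets the previous ones in a cone whose
apex is its face opposite to `x`. -/
theorem contractibleOn_cofaces_diff [DecidableEq V] {b : Finset V} {S : Set V} {x : V}
    (hSfin : S.Finite) (hxb : x ∉ b)
    (h : ContractibleOn (comparability V) (cofaces G b (S \ {x}))) :
    ContractibleOn (comparability V) (cofaces G b S \ {insert x b}) := by
  have hfin : (cofaces G b S \ {insert x b}).Finite :=
    (cofaces_finite hSfin).subset Set.sdiff_subset
  refine h.extend (fun s => -(s.card : ℤ)) ?_ hfin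
    (fun s _ t _ hst => by have := comparability_card_ne hst; omega) ?_
  · rintro s ⟨h1, h2, h3⟩
    refine ⟨⟨h1, fun v hv hvb => (h2 v hv hvb).1, h3⟩, ?_⟩
    rintro rfl
    exact (h2 x (Finset.mem_insert_self x b) hxb).2 rfl
  · rintro s ⟨hs, hne⟩ hsT
    have hxs : x ∈ s := by
      by_contra hxs
      exact hsT ⟨hs.1, fun v hv hvb => ⟨hs.2.1 v hv hvb, fun h => hxs (h ▸ hv)⟩, hs.2.2⟩
    have hbs := ssubset_insert_of_mem_cofaces hs hxs hne
    have hbe : b ⊂ s.erase x := by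
      obtain ⟨v, hv, hvb⟩ := Finset.exists_of_ssubset hbs
      rw [Finset.mem_insert, not_or] at hvb
      exact Finset.ssubset_iff_of_subset (fun w hw => Finset.mem_erase.2
        ⟨ne_of_mem_of_not_mem hw hxb, hs.1.subset hw⟩) |>.2 ⟨v, Finset.mem_erase.2 ⟨hvb.1, hv⟩, hvb.2⟩
    have hsub : s.erase x ⊂ s := Finset.erase_ssubset hxs
    have hmem : s.erase x ∈ cofaces G b (S \ {x}) :=
      ⟨hbe, fun v hv hvb => ⟨hs.2.1 v (hsub.subset hv) hvb, Finset.ne_of_mem_erase hv⟩,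
        fun v hv hvb w hw => hs.2.2 v (hsub.subset hv) hvb w (hsub.subset hw)⟩
    refine .of_apex (hfin.subset fun t ht => ht.1.1) (s.erase x)
      ⟨⟨⟨⟨hbe, fun v hv hvb => (hmem.2.1 v hv hvb).1, hmem.2.2⟩, ?_⟩, Or.inl hmem⟩,
        Or.inr hsub⟩ ?_
    · intro h
      have : x ∈ s.erase x := h ▸ Finset.mem_insert_self x b
      simp at this
    · rintro t ⟨⟨-, htT⟩, hst⟩ htne
      refine comparability_adj_of_subset ?_ htne.symm
      rcases hst with hst | hst
      · exact Or.inl (hsub.subset.trans hst.subset)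
      · right
        rcases htT with htT | htT
        · exact fun v hv => Finset.mem_erase.2
            ⟨fun h => (htT.2.1 x (h ▸ hv) hxb).2 rfl, hst.subset hv⟩
        · have := Finset.card_lt_card hst
          omega

/-- The Barycentric refinement of a contractible graph is contractible. -/
theorem ContractibleOn.cofaces [DecidableEq V] {S : Set V} (hS : ContractibleOn G S)
    (b : Finset V) (hb : ∀ v ∈ S, v ∉ b) :
    ContractibleOn (comparability V) (cofaces G b S) := by
  induction hS generalizing b with
  | point x =>
    have hxb := hb x rfl
    have : KnillGraph.cofaces G b {x} = {insert x b} := by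
      ext s
      constructor
      · rintro ⟨h1, h2, -⟩
        refine Finset.Subset.antisymm (fun v hv => ?_) ?_
        · by_cases hvb : v ∈ b
          · exact Finset.mem_insert_of_mem hvb
          · rw [show v = x from h2 v hv hvb]
            exact Finset.mem_insert_self x b
        · obtain ⟨v, hv, hvb⟩ := Finset.exists_of_ssubset h1
          exact Finset.insert_subset ((h2 v hv hvb : v = x) ▸ hv) h1.subset
      · rintro rfl
        have key : ∀ v ∈ insert x b, v ∉ b → v = x := fun v hv hvb =>
          (Finset.mem_insert.1 hv).resolve_right hvb
        exact ⟨Finset.ssubset_insert hxb, key, fun v hv hvb w hw hwb hne =>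
          absurd ((key v hv hvb).trans (key w hw hwb).symm) hne⟩
    rw [this]
    exact .point _
  | @step S x hx hN hR ihN ihR =>
    have hxb := hb x hx
    have hSfin : S.Finite := (ContractibleOn.step x hx hN hR).finite
    refine .step (insert x b) ?_ ?_
      (contractibleOn_cofaces_diff hSfin hxb (ihR b fun v hv => hb v hv.1))
    · have key : ∀ v ∈ insert x b, v ∉ b → v = x := fun v hv hvb =>
        (Finset.mem_insert.1 hv).resolve_right hvb
      exact ⟨Finset.ssubset_insert hxb, fun v hv hvb => (key v hv hvb).symm ▸ hx,
        fun v hv hvb w hw hwb hne => absurd ((key v hv hvb).trans (key w hw hwb).symm) hne⟩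
    · have h := ihN (insert x b) (fun v hv hvb => by
        rcases Finset.mem_insert.1 hvb with rfl | hvb
        · exact G.irrefl hv.2
        · exact hb v hv.1 hvb)
      convert h using 1
      ext s
      constructor
      · rintro ⟨⟨h1, h2, h3⟩, hs | hs⟩
        · have hxs : x ∈ s := hs.subset (Finset.mem_insert_self x b)
          refine ⟨hs, fun v hv hvb => ?_, fun v hv hvb w hw hwb => ?_⟩
          · rw [Finset.mem_insert, not_or] at hvb
            exact ⟨h2 v hv hvb.2, h3 x hxs hxb v hv hvb.2 (Ne.symm hvb.1)⟩
          · rw [Finset.mem_insert, not_or] at hvb hwb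
            exact h3 v hv hvb.2 w hw hwb.2
        · have h4 := Finset.card_lt_card h1
          have h5 := Finset.card_lt_card hs
          rw [Finset.card_insert_of_notMem hxb] at h5
          omega
      · rintro ⟨h1, h2, h3⟩
        refine ⟨⟨(Finset.ssubset_insert hxb).trans h1, fun v hv hvb => ?_,
          fun v hv hvb w hw hwb hne => ?_⟩, Or.inl h1⟩
        · by_cases hvx : v = x
          · exact hvx ▸ hx
          · exact (h2 v hv (by simp [hvx, hvb])).1
        · by_cases hvx : v = x
          · subst hvx
            exact (h2 w hw (by simp [hne.symm, hwb])).2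
          · by_cases hwx : w = x
            · subst hwx
              exact (h2 v hv (by simp [hne, hvb])).2.symm
            · exact h3 v hv (by simp [hvx, hvb]) w hw (by simp [hwx, hwb]) hne

/-- The Barycentric refinement of a sphere is a sphere: the unit sphere of a simplex is the join of
its refined boundary with the refinement of its link. -/
theorem SphereOn.cofaces [DecidableEq V] {n : ℕ} {S : Set V} (hS : SphereOn G n S)
    (b : Finset V) (hb : ∀ v ∈ S, v ∉ b) :
    SphereOn (comparability V) n (cofaces G b S) := by
  induction n using Nat.strong_induction_on generalizing S b with
  | _ n ih =>
    cases n with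
    | zero =>
      refine Set.eq_empty_of_forall_notMem fun s hs => ?_
      obtain ⟨v, hv, hvb⟩ := Finset.exists_of_ssubset hs.1
      have := hs.2.1 v hv hvb
      rw [show S = ∅ from hS] at this
      exact this
    | succ n =>
      refine ⟨fun s hs => ?_, ?_⟩
      · have hcard := Finset.card_lt_card hs.1
        obtain ⟨m, hm, hlink⟩ := hS.link (s \ b)
          (fun v hv => hs.2.1 v (Finset.mem_sdiff.1 hv).1 (Finset.mem_sdiff.1 hv).2)
          (fun v hv w hw hne => by
            rw [Finset.mem_coe, Finset.mem_sdiff] at hv hw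
            exact hs.2.2 v hv.1 hv.2 w hw.1 hw.2 hne)
        rw [Finset.card_sdiff_of_subset hs.1.subset] at hm
        have hlow := sphereOn_Ioo (s.card - b.card - 1) b s hs.1.subset (by omega)
        have hup := ih m (by omega) hlink s (fun v hv hvs =>
          G.irrefl (hv.2 v (Finset.mem_sdiff.2 ⟨hvs, hb v hv.1⟩)))
        have h := hlow.join hup (fun a ha t ht => Or.inl (ha.2.trans ht.1))
        rw [show s.card - b.card - 1 + m = n by omega] at h
        convert h using 1
        ext t
        constructor
        · rintro ⟨ht, hst | hst⟩
          · refine Or.inr ⟨hst, fun v hv hvs => ⟨ht.2.1 v hv fun h => hvs (hs.1.subset h),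
              fun w hw => ?_⟩, fun v hv hvs w hw hws => ht.2.2 v hv (fun h => hvs (hs.1.subset h))
                w hw (fun h => hws (hs.1.subset h))⟩
            rw [Finset.mem_sdiff] at hw
            exact ht.2.2 w (hst.subset hw.1) hw.2 v hv (fun h => hvs (hs.1.subset h))
              (by rintro rfl; exact hvs hw.1)
          · exact Or.inl ⟨ht.1, hst⟩
        · rintro (ht | ht)
          · exact ⟨⟨ht.1, fun v hv => hs.2.1 v (ht.2.le hv), fun v hv hvb w hw =>
              hs.2.2 v (ht.2.le hv) hvb w (ht.2.le hw)⟩, Or.inr ht.2⟩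
          · refine ⟨⟨hs.1.trans ht.1, fun v hv hvb => ?_, fun v hv hvb w hw hwb hne => ?_⟩,
              Or.inl ht.1⟩
            · by_cases hvs : v ∈ s
              · exact hs.2.1 v hvs hvb
              · exact (ht.2.1 v hv hvs).1
            · by_cases hvs : v ∈ s
              · by_cases hws : w ∈ s
                · exact hs.2.2 v hvs hvb w hws hwb hne
                · exact (ht.2.1 w hw hws).2 v (Finset.mem_sdiff.2 ⟨hvs, hvb⟩)
              · by_cases hws : w ∈ s
                · exact ((ht.2.1 v hv hvs).2 w (Finset.mem_sdiff.2 ⟨hws, hwb⟩)).symm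
                · exact ht.2.2 v hv hvs w hw hws hne
      · have hfin := hS.finite
        obtain ⟨-, x, hx, hc⟩ := hS
        have hxb := hb x hx
        have key : ∀ v ∈ insert x b, v ∉ b → v = x := fun v hv hvb =>
          (Finset.mem_insert.1 hv).resolve_right hvb
        exact ⟨insert x b, ⟨Finset.ssubset_insert hxb, fun v hv hvb => (key v hv hvb).symm ▸ hx,
          fun v hv hvb w hw hwb hne => absurd ((key v hv hvb).trans (key w hw hwb).symm) hne⟩,
          contractibleOn_cofaces_diff hfin hxb (hc.cofaces b fun v hv => hb v hv.1)⟩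

end Refinement

/-! ### Level surfaces -/

section Level

variable {V : Type u} {G : SimpleGraph V}

/-- The vertices of a level surface as finite sets of vertices of the graph. -/
def levelSurfaceEmbedding (G : SimpleGraph V) (f : V → ℝ) (c : ℝ) :
    levelSurface G f c ↪g comparability V where
  toFun s := s.1.1
  inj' _ _ h := Subtype.ext (Subtype.ext h)
  map_rel_iff' := Iff.rfl

/-- In a `d`-graph the link of a nonempty clique `s` is a `(d - |s|)`-sphere. -/
theorem IsDGraph.link [DecidableEq V] {d : ℤ} (hG : IsDGraph d G) {s : Finset V}
    (hne : s.Nonempty) (hs : G.IsClique (s : Set V)) :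
    ∃ m : ℕ, (m : ℤ) + s.card = d + 1 ∧ SphereOn G m {w | ∀ v ∈ s, G.Adj v w} := by
  obtain ⟨x, hx⟩ := hne
  obtain ⟨n, hn, hsph⟩ := hG x
  rw [isSphereSucc_iff_sphereOn_range n (unitSphereEmbedding .refl x),
    range_unitSphereEmbedding] at hsph
  obtain ⟨m, hm, h⟩ := hsph.link (s.erase x)
    (fun v hv => ⟨⟨v, rfl⟩, hs hx (Finset.mem_of_mem_erase hv) (Finset.ne_of_mem_erase hv).symm⟩)
    (hs.subset (by simp))
  refine ⟨m, ?_, ?_⟩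
  · have := Finset.card_erase_add_one hx
    omega
  · convert h using 1
    ext w
    constructor
    · exact fun hw => ⟨⟨⟨w, rfl⟩, hw x hx⟩, fun v hv => hw v (Finset.mem_of_mem_erase hv)⟩
    · rintro ⟨⟨-, hxw⟩, hw⟩ v hv
      by_cases hvx : v = x
      · exact hvx ▸ hxw
      · exact hw v (Finset.mem_erase.2 ⟨hvx, hv⟩)

/-- A level surface of a function on a `d`-graph which avoids the level is a `(d - 1)`-graph. -/
theorem IsDGraph.levelSurface {d : ℤ} (hG : IsDGraph d G) {f : V → ℝ} {c : ℝ}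
    (hf : ∀ v, f v ≠ c) : IsDGraph (d - 1) (levelSurface G f c) := by
  classical
  rintro ⟨⟨s, hsne, hcl⟩, hsf⟩
  have hmix : ∀ t : Finset V, ((∃ v ∈ t, f v - c < 0) ∧ ∃ v ∈ t, 0 < f v - c) ↔
      Mixed (fun v => f v - c < 0) t := by
    intro t
    have : ∀ v, 0 < f v - c ↔ ¬ f v - c < 0 := fun v =>
      ⟨fun h => h.le.not_gt, fun h => (not_lt.1 h).lt_of_ne' (sub_ne_zero.2 (hf v))⟩
    simp only [Mixed, this]
  have hs := (hmix s).1 hsf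
  obtain ⟨m, hm, hlink⟩ := hG.link hsne hcl
  have htwo : 2 ≤ s.card := by
    obtain ⟨⟨v, hv, hpv⟩, w, hw, hpw⟩ := hs
    exact Finset.one_lt_card.2 ⟨v, hv, w, hw, by rintro rfl; exact hpw hpv⟩
  have hlow := sphereOn_mixed _ (s.card - 2) s hs (by omega)
  have hup := hlink.cofaces s (fun v hv hvs => G.irrefl (hv v hvs))
  have h := hlow.join hup (fun a ha t ht => Or.inl (ha.1.trans ht.1))
  refine ⟨s.card - 2 + m, by push_cast [Nat.cast_sub htwo]; omega, ?_⟩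
  rw [isSphereSucc_iff_sphereOn_range _ (unitSphereEmbedding (levelSurfaceEmbedding G f c) _),
    range_unitSphereEmbedding]
  convert h using 1
  ext t
  constructor
  · rintro ⟨⟨⟨⟨t, htne, htcl⟩, htf⟩, rfl⟩, hst | hst⟩
    · have hst : s ⊂ t := hst
      exact Or.inr ⟨hst, fun v hv hvs w hw =>
        htcl (hst.subset hw) hv (by rintro rfl; exact hvs hw),
        fun v hv _ w hw _ hne => htcl hv hw hne⟩
    · exact Or.inl ⟨hst, (hmix t).1 htf⟩
  · rintro (⟨hts, ht⟩ | ⟨hst, h1, h2⟩)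
    · obtain ⟨v, hv, -⟩ := ht.1
      exact ⟨⟨⟨⟨t, ⟨v, hv⟩, hcl.subset (by simpa using hts.subset)⟩, (hmix t).2 ht⟩, rfl⟩, Or.inr hts⟩
    · have htcl : G.IsClique (t : Set V) := by
        intro v hv w hw hne
        by_cases hvs : v ∈ s
        · by_cases hws : w ∈ s
          · exact hcl hvs hws hne
          · exact h1 w hw hws v hvs
        · by_cases hws : w ∈ s
          · exact (h1 v hv hvs w hws).symm
          · exact h2 v hv hvs w hw hws hne
      exact ⟨⟨⟨⟨t, hsne.mono hst.subset, htcl⟩, (hmix t).2 (hs.mono hst.subset)⟩, rfl⟩, Or.inl hst⟩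

theorem StronglyLocallyInjective.simplexAverage_ne_zero {g : V → ℝ}
    (hg : StronglyLocallyInjective G g) (s : Simplex G) : simplexAverage G g s ≠ 0 := by
  have hcard : (s.1.card : ℝ) ≠ 0 := by exact_mod_cast s.2.1.card_pos.ne'
  refine div_ne_zero (fun h => ?_) hcard
  obtain ⟨v, hv⟩ := s.2.1
  have := Fintype.linearIndependent_iff.1 (hg s.1 s.2.2) (fun _ => 1)
    (by simpa [Finset.sum_attach s.1 g] using h) ⟨v, hv⟩
  exact one_ne_zero this

/-- A level surface inside an induced subgraph `H = K.induce A` lies in the Barycentric refinement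
of `K`. -/
def levelSurfaceInduceEmbedding (K : SimpleGraph V) (A : Set V) (f : A → ℝ) (c : ℝ) :
    levelSurface (K.induce A) f c ↪g barycentric K where
  toFun s := ⟨s.1.1.map (Function.Embedding.subtype _), s.1.2.1.map, by
    intro v hv w hw hne
    simp only [Finset.coe_map, Set.mem_image, Finset.mem_coe] at hv hw
    obtain ⟨v, hv, rfl⟩ := hv
    obtain ⟨w, hw, rfl⟩ := hw
    exact s.1.2.2 hv hw (fun h => hne (congrArg _ h))⟩
  inj' _ _ h := Subtype.ext (Subtype.ext (Finset.map_injective _ (congrArg Subtype.val h)))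
  map_rel_iff' := or_congr (Finset.map_ssubset_map) (Finset.map_ssubset_map)

end Level

end KnillGraph

theorem mainTheorem10 {V : Type*} [Fintype V] [DecidableEq V] (G : SimpleGraph V)
    [DecidableRel G.Adj] (d : ℕ) (hG : KnillGraph.IsDGraph (d : ℤ) G) (f₂ f₃ : V → ℝ)
    (h₂ : KnillGraph.IsKthEigenfunction G 2 f₂) (h₃ : KnillGraph.IsKthEigenfunction G 3 f₃)
    (hinj₂ : KnillGraph.StronglyLocallyInjective G f₂)
    (hinj₃ : KnillGraph.StronglyLocallyInjective G f₃)
    (hne₂ : ∀ v, f₂ v ≠ 0) (hne₃ : ∀ v, f₃ v ≠ 0) :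
    KnillGraph.IsDGraph ((d : ℤ) - 2) (KnillGraph.doubleNodalSurface G f₂ f₃) ∧
      ∃ φ : KnillGraph.doubleNodalSurface G f₂ f₃ ↪g
          KnillGraph.barycentric (KnillGraph.barycentric G),
        ∀ s, (φ s).1 = s.1.1.map (Function.Embedding.subtype _) := by
  refine ⟨?_, KnillGraph.levelSurfaceInduceEmbedding _ _ _ _, fun _ => rfl⟩
  rw [show (d : ℤ) - 2 = d - 1 - 1 by ring]
  exact (hG.levelSurface hne₂).levelSurface fun s => hinj₃.simplexAverage_ne_zero s.1
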